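/- **Setting.** Let $c,d,n,T$ be natural numbers. Write a weight vector as $\mathbf w=[\mathbf w_1,\dots,\mathbf w_c]\in\mathbb R^{cd}$ with $\mathbf w_k\in\mathbb R^d$ and Euclidean norm $\|\cdot\|_2$. Let $\lambda,\mu\in\mathbb R$, $\varsigma>0$ and a bias vector $\mathbf b\in\mathbb R^c$ be fixed. For an example $(\mathbf x,y)\in\mathbb R^d\times\{1,\dots,c\}$ put $\gamma_k=1-(\mathbf w_y^\top\mathbf x+b_y-\mathbf w_k^\top\mathbf x-b_k)$. Its contribution to the smoothed M$^3$-SVM objective is $$\ell_{(\mathbf x,y)}(\mathbf w)=\sum_{k\ne y}\frac{\gamma_k+\sqrt{\gamma_k^2+\varsigma^2}}{2}+\lambda\sum_{k<l}\|\mathbf w_k-\mathbf w_l\|_2^2+\mu\bigl(\|\mathbf w\|_2^2+\|\mathbf b\|_2^2\bigr).$$ Its explicit per-example gradient is $\nabla(\mathbf x,y)=[\nabla_1,\dots,\nabla_c]$, where $$\nabla_k=\begin{cases}-\sum_{l\ne k}\dfrac{\gamma_l+\sqrt{\gamma_l^2+\varsigma^2}}{2\sqrt{\gamma_l^2+\varsigma^2}}\,\mathbf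 x+2\lambda\sum_{l\ne k}(\mathbf w_k-\mathbf w_l)+2\mu\mathbf w_k,&k=y,\\[8pt]\dfrac{\gamma_k+\sqrt{\gamma_k^2+\varsigma^2}}{2\sqrt{\gamma_k^2+\varsigma^2}}\,\mathbf x+2\lambda\sum_{l\ne k}(\mathbf w_k-\mathbf w_l)+2\mu\mathbf w_k,&k\ne y.\end{cases}$$ **Algorithm.** Fix $\mathbf w_0\in\mathbb R^{cd}$, learning rates $\eta_0,\dots,\eta_{T-1}\in\mathbb R$, a clipping norm $R>0$, a normalization $B\ge1$, a sampling probability $q\in[0,1]$ and $\sigma\in\mathbb R$, none of them depending on the data. On a data set with examples $(\mathbf x_i,y_i)$, $i\in\{1,\dots,n\}$, noisy gradient descent is $$\hat{\mathbf w}_0=\mathbf w_0,\qquad \hat{\mathbf w}_{t+1}=\hat{\mathbf w}_t-\eta_t\Bigl\{\frac1B\sum_{i\in S_t}\frac{\nabla^{(t)}(\mathbf x_i,y_i)}{\max(1,\|\nabla^{(t)}(\mathbf x_i,y_i)\|_2/R)}+\mathbf z_t\Bigr\},\qquad 0\le t<T,$$ where $\nabla^{(t)}$ is evaluated at $\hat{\mathbf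 w}_t$, the mini-batch $S_t$ contains each index independently with probability $q$ (Poisson sampling), $\mathbf z_t\sim\mathcal N(0,R^2\sigma^2\mathbf I)$, and $S_0,\mathbf z_0,\dots,S_{T-1},\mathbf z_{T-1}$ are independent. For $q=1$ and $B=n$ this is full-batch gradient descent with the average $\frac1n\sum_{i=1}^n$. **Privacy.** Two data sets are neighbouring if they differ in exactly one example, which is modified, deleted or inserted; the remaining examples keep their indices, and $B$ is not changed. A randomized mechanism $\mathcal M$ is $(\epsilon,\delta)$-DP if $\Pr[\mathcal M(D)\in O]\le e^\epsilon\Pr[\mathcal M(D')\in O]+\delta$ for all neighbouring $D,D'$ and all measurable sets $O$ of outputs. **Theorem (DP guarantee of gradient perturbation).** 1. The explicit per-example gradient is correct: $\ell_{(\mathbf x,y)}$ is differentiable in $\mathbf w$, and its gradient at every $\mathbf w$ is $\nabla(\mathbf x,y)$. 2. For every $K>0$ there are constants $c_1,c_2>0$, depending only on $K$, such that the following holds for all parameters as above. If $\epsilon>0$, $0<\delta<1$, $\epsilon\le K\log(1/\delta)$, $\epsilon<c_1q^2T$ and $$\sigma\ge c_2\,\frac{q\sqrt{T\log(1/\delta)}}{\epsilon},$$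 then the joint release of all iterates $(\hat{\mathbf w}_0,\dots,\hat{\mathbf w}_T)$ is $(\epsilon,\delta)$-DP, and so is the release of the final weight $\hat{\mathbf w}_T$. -/

import Mathlib

open MeasureTheory ProbabilityTheory

noncomputable section

namespace PMSVM

/-- The flattened weight vector `w = [w_1, …, w_c] ∈ ℝ^{c·d}` with the Euclidean norm. -/
abbrev Weights (c d : ℕ) : Type := EuclideanSpace ℝ (Fin c × Fin d)

/-- A labelled example `(x, y)` with `x ∈ ℝ^d` and `y` one of `c` classes. -/
abbrev Sample (c d : ℕ) : Type := EuclideanSpace ℝ (Fin d) × Fin c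

/-- A data set with `n` places, each of which holds a labelled example or is empty. A data set of
exactly `n` examples has no empty place; emptying a place is the deletion of an example. -/
abbrev Dataset (n c d : ℕ) : Type := Fin n → Option (Sample c d)

/-- Two data sets are neighbouring if they differ in exactly one example, that is, if one of them
arises from the other by the modification, the deletion or the insertion of one example. -/
def Neighbors {n c d : ℕ} (D D' : Dataset n c d) : Prop :=
  ∃ i, D i ≠ D' i ∧ ∀ j, j ≠ i → D j = D' j

/-- The randomized mechanism that draws `ω` from `P` and outputs `M D ω` on the data set `D`
is `(ε, δ)`-differentially private with respect to the neighbouring relation `Adj`. -/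
def IsDP {𝒟 Ω 𝒪 : Type*} [MeasurableSpace Ω] [MeasurableSpace 𝒪] (Adj : 𝒟 → 𝒟 → Prop)
    (P : Measure Ω) (M : 𝒟 → Ω → 𝒪) (ε δ : ℝ) : Prop :=
  ∀ D D', Adj D D' → ∀ O : Set 𝒪, MeasurableSet O →
    P {ω | M D ω ∈ O} ≤ ENNReal.ofReal (Real.exp ε) * P {ω | M D' ω ∈ O} + ENNReal.ofReal δ

section Objective

variable {c d : ℕ}

/-- The weight vector `w_k ∈ ℝ^d` of class `k`. -/
def classWeight (w : Weights c d) (k : Fin c) : EuclideanSpace ℝ (Fin d) :=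
  WithLp.toLp 2 fun j => w (k, j)

/-- The margin violation `γ_k = 1 - (w_yᵀ x + b_y - w_kᵀ x - b_k)`. -/
def margin (b : Fin c → ℝ) (w : Weights c d) (s : Sample c d) (k : Fin c) : ℝ :=
  1 - (inner ℝ (classWeight w s.2) s.1 + b s.2 - inner ℝ (classWeight w k) s.1 - b k)

/-- The smoothed hinge function `g_ς(γ) = (γ + √(γ² + ς²)) / 2`. -/
def smoothHinge (ς γ : ℝ) : ℝ := (γ + √(γ ^ 2 + ς ^ 2)) / 2

/-- The contribution of one example `s` to the smoothed M³-SVM objective: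
`∑_{k ≠ y} g_ς(γ_k) + lam ∑_{k < l} ‖w_k - w_l‖² + μ (‖W‖_F² + ‖b‖²)`. -/
def exampleObjective (lam μ ς : ℝ) (b : Fin c → ℝ) (s : Sample c d) (w : Weights c d) : ℝ :=
  (∑ k with k ≠ s.2, smoothHinge ς (margin b w s k))
    + lam * (∑ k, ∑ l with k < l, ‖classWeight w k - classWeight w l‖ ^ 2)
    + μ * (‖w‖ ^ 2 + ∑ k, b k ^ 2)

/-- The factor `(γ + √(γ² + ς²)) / (2 √(γ² + ς²))`. -/
def hingeSlope (ς γ : ℝ) : ℝ := (γ + √(γ ^ 2 + ς ^ 2)) / (2 * √(γ ^ 2 + ς ^ 2))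

/-- The block `∇_k ∈ ℝ^d` of the explicit gradient of one example. -/
def gradBlock (lam μ ς : ℝ) (b : Fin c → ℝ) (s : Sample c d) (w : Weights c d) (k : Fin c) :
    EuclideanSpace ℝ (Fin d) :=
  (if k = s.2 then -∑ l with l ≠ k, hingeSlope ς (margin b w s l) • s.1
    else hingeSlope ς (margin b w s k) • s.1)
    + (2 * lam) • (∑ l with l ≠ k, (classWeight w k - classWeight w l))
    + (2 * μ) • classWeight w k

/-- The explicit gradient `∇ = [∇_1, …, ∇_c]` of one example. -/
def exampleGradient (lam μ ς : ℝ) (b : Fin c → ℝ) (s : Sample c d) (w : Weights c d) :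
    Weights c d :=
  WithLp.toLp 2 fun p => gradBlock lam μ ς b s w p.1 p.2

end Objective

/-- Clipping to norm `R`: `v / max(1, ‖v‖ / R)`. -/
def clip {E : Type*} [NormedAddCommGroup E] [NormedSpace ℝ E] (R : ℝ) (v : E) : E :=
  (max 1 (‖v‖ / R))⁻¹ • v

/-- The randomness of one step: a random set of indices and a noise vector. -/
abbrev StepNoise (n c d : ℕ) : Type := Set (Fin n) × Weights c d

/-- The law of the randomness of `T` steps. The steps are independent; in each of them the
mini-batch contains every index independently with probability `q` (for `q = 1` it is the whole
data set), and, independently of it, the noise has law `N(0, R²σ² I)`. -/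
def noiseLaw (n c d T : ℕ) (q : unitInterval) (R σ : ℝ) :
    Measure (Fin T → StepNoise n c d) :=
  Measure.pi fun _ =>
    (setBernoulli (Set.univ : Set (Fin n)) q).prod
      (multivariateGaussian 0 ((R ^ 2 * σ ^ 2) • (1 : Matrix (Fin c × Fin d) (Fin c × Fin d) ℝ)))

/-- The clipped explicit gradient of the example in a place (zero if the place is empty). -/
def clippedGradient {c d : ℕ} (lam μ ς : ℝ) (b : Fin c → ℝ) (R : ℝ) (w : Weights c d) :
    Option (Sample c d) → Weights c d
  | none => 0
  | some s => clip R (exampleGradient lam μ ς b s w)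

open Classical in
/-- One update `w ↦ w - η { (1/B) ∑_{i ∈ S} clip_R(∇(x_i)) + z }` with mini-batch `S` and
noise `z`. -/
def gdStep {n c d : ℕ} (lam μ ς : ℝ) (b : Fin c → ℝ) (B R η : ℝ) (D : Dataset n c d)
    (ω : StepNoise n c d) (w : Weights c d) : Weights c d :=
  w - η • ((1 / B) • (∑ i with i ∈ ω.1, clippedGradient lam μ ς b R w (D i)) + ω.2)

/-- All iterates `w_0, w_1, …, w_T` of noisy gradient descent with learning rates `η_t`. -/
def iterates {n c d T : ℕ} (lam μ ς : ℝ) (b : Fin c → ℝ) (B R : ℝ) (η : Fin T → ℝ)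
    (w₀ : Weights c d) (D : Dataset n c d) (ω : Fin T → StepNoise n c d) :
    Fin (T + 1) → Weights c d :=
  Fin.induction (motive := fun _ => Weights c d) w₀
    fun t w => gdStep lam μ ς b B R (η t) D (ω t) w

/-- The final weight `w_T` of noisy gradient descent. -/
def finalWeight {n c d T : ℕ} (lam μ ς : ℝ) (b : Fin c → ℝ) (B R : ℝ) (η : Fin T → ℝ)
    (w₀ : Weights c d) (D : Dataset n c d) (ω : Fin T → StepNoise n c d) : Weights c d :=
  iterates lam μ ς b B R η w₀ D ω (Fin.last T)

end PMSVM

end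

/-! Neighbouring data sets become equal once the place `i` where they differ is emptied, so both
runs are compared with the run without that example. Write L for the log-likelihood ratio of a
Gaussian shift. Resampling whether `i` is in the mini-batch makes one step a mixture: with
probability q the noise is shifted by the clipped gradient over B. By Cameron–Martin this reweights
the noise by 1 - q + q e^L (`lintegral_gdStep`), and T steps by a product ρ of such factors along
the trajectory (`lintegral_iterates`).

If ρ' is the product for the other data set, then ρ ≤ e^ε ρ' + e^(-mε) ρ^(m+1) ρ'^(-m) pointwise, so
privacy reduces to a bound on one moment (`isDP_iterates_of_moment`). That moment multiplies over
steps because the one-step bound is uniform in the current weight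
(`lintegral_traceRatio_moment_le`). A step contributes exp(O(q² m² / σ²)) by
`lintegral_mixRatio_pow_mul_inv_pow_le`; the q² instead of q appears because e^L has mean one, which
kills the first-order term. Taking m about 2 log(1/δ)/ε balances the two exponents.

The gradient formula is the chain rule together with a symmetrization of the sum over pairs of
classes. -/

noncomputable section

namespace PMSVM

/-! ### Cameron–Martin formula for isotropic Gaussians. -/

section Gaussian
open Complex
variable {ι : Type*} [Fintype ι]

/-- The log-likelihood ratio of the shift by `v` of an isotropic Gaussian with standard
deviation `τ`. -/
def shiftLogRatio {E : Type*} [NormedAddCommGroup E] [InnerProductSpace ℝ E]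
    (τ : ℝ) (v z : E) : ℝ :=
  (inner ℝ v z - ‖v‖ ^ 2 / 2) / τ ^ 2

lemma integral_exp_mul_gaussianReal (z : ℂ) :
    ∫ x : ℝ, cexp (z * x) ∂(gaussianReal 0 1) = cexp (z ^ 2 / 2) := by
  have := complexMGF_id_gaussianReal (μ := 0) (v := 1) z
  simpa [complexMGF] using this

/-- Both sides have the same characteristic function: the tilted integral factors over coordinates
into complex exponential moments at v_i + i t_i, whose exponents sum to (‖v‖² - ‖t‖²)/2 + i⟨v, t⟩,
and the normalization removes ‖v‖²/2. -/
lemma stdGaussian_withDensity (v : EuclideanSpace ℝ ι) :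
    (stdGaussian (EuclideanSpace ℝ ι)).withDensity
      (fun z => ENNReal.ofReal (Real.exp (shiftLogRatio 1 v z)))
      = (stdGaussian (EuclideanSpace ℝ ι)).map (fun z => z + v) := by
  have hint : Integrable (fun z => Real.exp (shiftLogRatio 1 v z))
      (stdGaussian (EuclideanSpace ℝ ι)) := by
    rw [← map_pi_eq_stdGaussian, integrable_map_measure
      (by unfold shiftLogRatio; fun_prop) (by fun_prop)]
    have : Integrable (fun x : ι → ℝ => ∏ i, Real.exp (v i * x i))
        (Measure.pi fun _ => gaussianReal 0 1) :=
      Integrable.fintype_prod (f := fun i x => Real.exp (v i * x))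
        (fun i => integrable_exp_mul_gaussianReal (v i))
    refine (this.const_mul (Real.exp (-(‖v‖ ^ 2 / 2)))).congr (ae_of_all _ fun x => ?_)
    simp only [Function.comp, shiftLogRatio, PiLp.inner_apply, ← Real.exp_sum, ← Real.exp_add]
    congr 1
    simp [mul_comm]
    ring
  have : IsFiniteMeasure ((stdGaussian (EuclideanSpace ℝ ι)).withDensity
      (fun z => ENNReal.ofReal (Real.exp (shiftLogRatio 1 v z)))) :=
    isFiniteMeasure_withDensity_ofReal hint.2
  have hm : Measurable fun z : EuclideanSpace ℝ ι => Real.exp (shiftLogRatio 1 v z) := by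
    unfold shiftLogRatio; fun_prop
  apply Measure.ext_of_charFun (E := EuclideanSpace ℝ ι)
  ext t
  rw [charFun_map_add_const, charFun_stdGaussian, charFun_apply,
    integral_withDensity_eq_integral_toReal_smul (by fun_prop) (by simp),
    ← map_pi_eq_stdGaussian, integral_map (by fun_prop) (by fun_prop)]
  have key : ∀ x : ι → ℝ, (ENNReal.ofReal (Real.exp (shiftLogRatio 1 v (WithLp.toLp 2 x)))).toReal •
      cexp (inner ℝ (WithLp.toLp 2 x) t * I) =
      cexp (-(‖v‖ ^ 2 / 2 : ℝ)) * ∏ i, cexp ((v i + t i * I) * x i) := by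
    intro x
    rw [ENNReal.toReal_ofReal (Real.exp_pos _).le, real_smul, ofReal_exp, ← Complex.exp_add,
      ← Complex.exp_sum, ← Complex.exp_add]
    congr 1
    simp only [shiftLogRatio, PiLp.inner_apply]
    push_cast
    simp only [add_mul, Finset.sum_add_distrib, Finset.sum_mul]
    simp [mul_comm, mul_left_comm]
    ring
  simp_rw [key]
  rw [integral_const_mul,
    integral_fintype_prod_eq_prod (f := fun i (x : ℝ) => cexp ((v i + t i * I) * x))]
  simp_rw [integral_exp_mul_gaussianReal]
  rw [← Complex.exp_sum, ← Complex.exp_add, ← Complex.exp_add]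
  congr 1
  simp only [EuclideanSpace.real_norm_sq_eq, PiLp.inner_apply, ← ofReal_pow]
  have hsum : ∑ i, ((v i : ℂ) + t i * I) ^ 2 / 2
      = (∑ i, (v i : ℂ) ^ 2) / 2 - (∑ i, (t i : ℂ) ^ 2) / 2 + (∑ i, (v i : ℂ) * t i) * I := by
    rw [Finset.sum_div, Finset.sum_div, Finset.sum_mul, ← Finset.sum_sub_distrib,
      ← Finset.sum_add_distrib]
    refine Finset.sum_congr rfl fun i _ => ?_
    linear_combination (t i : ℂ) ^ 2 / 2 * I_sq
  rw [hsum]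
  simp [mul_comm]
  ring

lemma multivariateGaussian_smul_one [DecidableEq ι] (τ : ℝ) :
    multivariateGaussian (0 : EuclideanSpace ℝ ι) (τ ^ 2 • (1 : Matrix ι ι ℝ))
      = (stdGaussian (EuclideanSpace ℝ ι)).map (fun z => τ • z) := by
  apply Measure.ext_of_charFun (E := EuclideanSpace ℝ ι)
  ext t
  rw [charFun_multivariateGaussian (Matrix.PosSemidef.one.smul (sq_nonneg τ)), charFun_map_smul,
    charFun_stdGaussian, norm_smul, ← ofReal_pow, mul_pow, Real.norm_eq_abs]
  simp only [EuclideanSpace.real_norm_sq_eq, sq_abs]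
  congr 1
  simp [dotProduct, Matrix.smul_mulVec, Finset.mul_sum, Finset.sum_div, neg_div]
  refine Finset.sum_congr rfl fun i _ => ?_
  ring

/-- The Cameron–Martin formula for an isotropic Gaussian measure. -/
lemma lintegral_multivariateGaussian_add [DecidableEq ι] {τ : ℝ} (hτ : τ ≠ 0)
    (v : EuclideanSpace ℝ ι) {f : EuclideanSpace ℝ ι → ENNReal} (hf : Measurable f) :
    ∫⁻ z, f (z + v) ∂(multivariateGaussian 0 (τ ^ 2 • (1 : Matrix ι ι ℝ)))
      = ∫⁻ z, ENNReal.ofReal (Real.exp (shiftLogRatio τ v z)) * f z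
        ∂(multivariateGaussian 0 (τ ^ 2 • (1 : Matrix ι ι ℝ))) := by
  have hm : ∀ (s : ℝ) (u : EuclideanSpace ℝ ι),
      Measurable fun z : EuclideanSpace ℝ ι => Real.exp (shiftLogRatio s u z) := by
    intro s u; unfold shiftLogRatio; fun_prop
  have h1 := hm τ v
  have h2 := hm 1 (τ⁻¹ • v)
  rw [multivariateGaussian_smul_one, lintegral_map (by fun_prop) (by fun_prop),
    lintegral_map (by fun_prop) (by fun_prop)]
  have h := lintegral_map (μ := stdGaussian (EuclideanSpace ℝ ι)) (f := fun z => f (τ • z))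
    (g := fun z => z + τ⁻¹ • v) (by fun_prop) (by fun_prop)
  rw [← stdGaussian_withDensity,
    lintegral_withDensity_eq_lintegral_mul _ (by fun_prop) (by fun_prop)] at h
  simp only [smul_add, smul_inv_smul₀ hτ] at h
  rw [← h]
  refine lintegral_congr fun z => ?_
  simp only [Pi.mul_apply, shiftLogRatio, inner_smul_left, inner_smul_right, norm_smul, mul_pow]
  congr 3
  simp
  field_simp
end Gaussian

/-! ### Moments of the likelihood ratio of subsampled Gaussians. -/

section Moments
variable {ι : Type*} [Fintype ι] [DecidableEq ι]

/-- The isotropic centred Gaussian measure with standard deviation `τ` in each direction. -/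
abbrev isoGaussian (ι : Type*) [Fintype ι] [DecidableEq ι] (τ : ℝ) :
    Measure (EuclideanSpace ℝ ι) :=
  multivariateGaussian 0 (τ ^ 2 • (1 : Matrix ι ι ℝ))

@[fun_prop]
lemma measurable_shiftLogRatio {E : Type*} [NormedAddCommGroup E] [InnerProductSpace ℝ E]
    [MeasurableSpace E] [BorelSpace E] [SecondCountableTopology E] {α : Type*} [MeasurableSpace α]
    (τ : ℝ) {v z : α → E}
    (hv : Measurable v) (hz : Measurable z) : Measurable fun a => shiftLogRatio τ (v a) (z a) := by
  unfold shiftLogRatio; fun_prop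

lemma shiftLogRatio_add {E : Type*} [NormedAddCommGroup E] [InnerProductSpace ℝ E]
    {τ : ℝ} (v z : E) :
    shiftLogRatio τ v (z + v) = ‖v‖ ^ 2 / τ ^ 2 + shiftLogRatio τ v z := by
  simp only [shiftLogRatio, inner_add_right, real_inner_self_eq_norm_sq]
  ring

lemma lintegral_exp_shiftLogRatio {τ : ℝ} (hτ : τ ≠ 0) (v : EuclideanSpace ℝ ι) :
    ∫⁻ z, ENNReal.ofReal (Real.exp (shiftLogRatio τ v z)) ∂(isoGaussian ι τ) = 1 := by
  have := lintegral_multivariateGaussian_add hτ v (f := fun _ => 1) (by fun_prop)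
  simpa using this.symm

/-- Completing the square: a power of a shift's likelihood ratio is a constant times the likelihood
ratio of the scaled shift. All exponential moments of L then follow from total mass one. -/
lemma exp_mul_shiftLogRatio {E : Type*} [NormedAddCommGroup E] [InnerProductSpace ℝ E]
    {τ : ℝ} (v z : E) (a : ℝ) :
    Real.exp (a * shiftLogRatio τ v z)
      = Real.exp (a * (a - 1) / 2 * (‖v‖ ^ 2 / τ ^ 2)) * Real.exp (shiftLogRatio τ (a • v) z) := by
  rw [← Real.exp_add]
  congr 1
  simp only [shiftLogRatio, inner_smul_left, norm_smul, mul_pow, Real.norm_eq_abs, sq_abs]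
  simp
  ring

lemma integrable_exp_shiftLogRatio {τ : ℝ} (hτ : τ ≠ 0) (v : EuclideanSpace ℝ ι) :
    Integrable (fun z => Real.exp (shiftLogRatio τ v z)) (isoGaussian ι τ) := by
  refine ⟨by fun_prop, ?_⟩
  rw [hasFiniteIntegral_iff_ofReal (ae_of_all _ fun _ => (Real.exp_pos _).le),
    lintegral_exp_shiftLogRatio hτ]
  simp

lemma integrable_exp_mul_shiftLogRatio {τ : ℝ} (hτ : τ ≠ 0) (v : EuclideanSpace ℝ ι) (a : ℝ) :
    Integrable (fun z => Real.exp (a * shiftLogRatio τ v z)) (isoGaussian ι τ) := by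
  simp_rw [exp_mul_shiftLogRatio]
  exact (integrable_exp_shiftLogRatio hτ _).const_mul _

lemma integral_exp_mul_shiftLogRatio {τ : ℝ} (hτ : τ ≠ 0) (v : EuclideanSpace ℝ ι) (a : ℝ) :
    ∫ z, Real.exp (a * shiftLogRatio τ v z) ∂(isoGaussian ι τ)
      = Real.exp (a * (a - 1) / 2 * (‖v‖ ^ 2 / τ ^ 2)) := by
  simp_rw [exp_mul_shiftLogRatio]
  rw [integral_const_mul, integral_eq_lintegral_of_nonneg_ae
    (ae_of_all _ fun _ => (Real.exp_pos _).le) (by fun_prop), lintegral_exp_shiftLogRatio hτ]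
  simp

/-- The likelihood ratio of the mixture `(1 - q) N(0, τ² I) + q N(v, τ² I)` to `N(0, τ² I)`. -/
def mixRatio {E : Type*} [NormedAddCommGroup E] [InnerProductSpace ℝ E] (τ q : ℝ) (v z : E) : ℝ :=
  1 - q + q * Real.exp (shiftLogRatio τ v z)

lemma one_sub_add_mul_pos {q y : ℝ} (hq0 : 0 ≤ q) (hq1 : q ≤ 1) (hy : 0 < y) :
    0 < 1 - q + q * y := by
  rcases hq0.eq_or_lt with rfl | h
  · simp
  · have := mul_pos h hy; linarith

lemma mixRatio_pos {E : Type*} [NormedAddCommGroup E] [InnerProductSpace ℝ E] {τ q : ℝ}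
    (hq0 : 0 ≤ q) (hq1 : q ≤ 1) (v z : E) : 0 < mixRatio τ q v z :=
  one_sub_add_mul_pos hq0 hq1 (Real.exp_pos _)

@[fun_prop]
lemma measurable_mixRatio {E : Type*} [NormedAddCommGroup E] [InnerProductSpace ℝ E]
    [MeasurableSpace E] [BorelSpace E] [SecondCountableTopology E] {α : Type*} [MeasurableSpace α]
    (τ q : ℝ) {v z : α → E}
    (hv : Measurable v) (hz : Measurable z) : Measurable fun a => mixRatio τ q (v a) (z a) := by
  unfold mixRatio; fun_prop

lemma exp_sub_one_le_two_mul {y : ℝ} (h0 : 0 ≤ y) (h1 : y ≤ 1) : Real.exp y - 1 ≤ 2 * y := by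
  have := Real.abs_exp_sub_one_le (x := y) (by rwa [abs_of_nonneg h0])
  rw [abs_of_nonneg h0] at this
  exact (le_abs_self _).trans this

/-- Induction on m, splitting off one factor. Its part q e^(θ+L) is a change of measure that shifts
z by v and so raises L by x = ‖v‖²/τ²; the tilt θ is there to absorb this, and the condition on θ
pays for one such shift per factor. -/
lemma lintegral_tilted_mixRatio_pow_le {τ q : ℝ} (hτ : τ ≠ 0) (hq0 : 0 ≤ q) (hq1 : q ≤ 1)
    (v : EuclideanSpace ℝ ι) (m : ℕ) : ∀ θ : ℝ, 0 ≤ θ → θ + 2 * m * (‖v‖ ^ 2 / τ ^ 2) ≤ 1 →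
    ∫⁻ z, ENNReal.ofReal ((1 - q + q * Real.exp (θ + shiftLogRatio τ v z)) ^ m) ∂(isoGaussian ι τ)
      ≤ ENNReal.ofReal (Real.exp (2 * q * m * θ + 2 * q ^ 2 * m ^ 2 * (‖v‖ ^ 2 / τ ^ 2))) := by
  set x := ‖v‖ ^ 2 / τ ^ 2 with hx
  have hx0 : 0 ≤ x := by positivity
  induction m with
  | zero => intro θ _ _; simp
  | succ m ih =>
    intro θ h0 h1
    push_cast at h1
    have hmx : 0 ≤ (m : ℝ) * x := by positivity
    have hpos : ∀ z, 0 ≤ (1 - q + q * Real.exp (θ + shiftLogRatio τ v z)) ^ m := fun z =>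
      pow_nonneg (one_sub_add_mul_pos hq0 hq1 (Real.exp_pos _)).le _
    have hsplit : ∀ z, ENNReal.ofReal ((1 - q + q * Real.exp (θ + shiftLogRatio τ v z)) ^ (m + 1))
        = ENNReal.ofReal (1 - q) *
            ENNReal.ofReal ((1 - q + q * Real.exp (θ + shiftLogRatio τ v z)) ^ m)
          + ENNReal.ofReal (q * Real.exp θ) * (ENNReal.ofReal (Real.exp (shiftLogRatio τ v z)) *
            ENNReal.ofReal ((1 - q + q * Real.exp (θ + shiftLogRatio τ v z)) ^ m)) := by
      intro z
      have := hpos z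
      rw [← ENNReal.ofReal_mul (by linarith), ← ENNReal.ofReal_mul (by positivity),
        ← ENNReal.ofReal_mul (by positivity), ← ENNReal.ofReal_add]
      · congr 1
        rw [pow_succ]
        conv_lhs => rw [Real.exp_add θ]
        conv_rhs => rw [Real.exp_add θ]
        ring
      · exact mul_nonneg (by linarith) this
      · positivity
    simp_rw [hsplit]
    rw [lintegral_add_left (by fun_prop), lintegral_const_mul _ (by fun_prop),
      lintegral_const_mul _ (by fun_prop),
      ← lintegral_multivariateGaussian_add hτ v
        (f := fun z => ENNReal.ofReal ((1 - q + q * Real.exp (θ + shiftLogRatio τ v z)) ^ m))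
        (by fun_prop)]
    simp_rw [shiftLogRatio_add, ← hx, ← add_assoc]
    refine (add_le_add (mul_le_mul_right (ih θ h0 (by linarith)) _)
      (mul_le_mul_right (ih (θ + x) (by linarith) (by linarith)) _)).trans ?_
    rw [← ENNReal.ofReal_mul (by linarith), ← ENNReal.ofReal_mul (by positivity),
      ← ENNReal.ofReal_add (mul_nonneg (by linarith) (Real.exp_pos _).le) (by positivity)]
    refine ENNReal.ofReal_le_ofReal ?_
    -- The split-off factor costs 1 + q(e^y - 1) ≤ e^(2qy), and 2qy = 2qθ + 4q²mx fits into the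
    -- growth of the exponent from m to m + 1.
    set y := θ + 2 * q * m * x with hy
    have hqm : q * (m * x) ≤ 1 * (m * x) := mul_le_mul_of_nonneg_right hq1 hmx
    have hqm0 : 0 ≤ q * (m * x) := by positivity
    have hy0 : 0 ≤ y := by rw [hy]; nlinarith
    have hy1 : y ≤ 1 := by rw [hy]; nlinarith
    have e1 : Real.exp (2 * q * m * (θ + x) + 2 * q ^ 2 * m ^ 2 * x)
        = Real.exp (2 * q * m * θ + 2 * q ^ 2 * m ^ 2 * x) * Real.exp (2 * q * m * x) := by
      rw [← Real.exp_add]; ring_nf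
    calc (1 - q) * Real.exp (2 * q * m * θ + 2 * q ^ 2 * m ^ 2 * x) +
          q * Real.exp θ * Real.exp (2 * q * m * (θ + x) + 2 * q ^ 2 * m ^ 2 * x)
        = Real.exp (2 * q * m * θ + 2 * q ^ 2 * m ^ 2 * x) * (q * (Real.exp y - 1) + 1) := by
          rw [e1, hy, Real.exp_add θ (2 * q * m * x)]; ring
      _ ≤ Real.exp (2 * q * m * θ + 2 * q ^ 2 * m ^ 2 * x) * Real.exp (q * (2 * y)) := by
          gcongr
          refine le_trans ?_ (Real.add_one_le_exp _)
          gcongr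
          exact exp_sub_one_le_two_mul hy0 hy1
      _ ≤ _ := by
          rw [← Real.exp_add]
          apply Real.exp_le_exp.2
          push_cast
          rw [hy]
          have : 0 ≤ q ^ 2 * x := by positivity
          nlinarith

lemma lintegral_mixRatio_pow_le {τ q : ℝ} (hτ : τ ≠ 0) (hq0 : 0 ≤ q) (hq1 : q ≤ 1)
    (v : EuclideanSpace ℝ ι) (m : ℕ) (h : 2 * m * (‖v‖ ^ 2 / τ ^ 2) ≤ 1) :
    ∫⁻ z, ENNReal.ofReal (mixRatio τ q v z ^ m) ∂(isoGaussian ι τ)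
      ≤ ENNReal.ofReal (Real.exp (2 * (q ^ 2 * m ^ 2 * (‖v‖ ^ 2 / τ ^ 2)))) := by
  have := lintegral_tilted_mixRatio_pow_le hτ hq0 hq1 v m 0 le_rfl (by linarith)
  simpa [mixRatio, mul_assoc] using this

lemma pow_le_one_add_pow {g : ℝ} (hg : 0 < g) {j N : ℕ} (h : j ≤ N) : g ^ j ≤ 1 + g ^ N := by
  rcases le_total g 1 with h1 | h1
  · have := pow_le_one₀ hg.le h1 (n := j)
    have := pow_pos hg N
    linarith
  · have := pow_le_pow_right₀ h1 h
    linarith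

/-- Second-order Taylor bound at 1, by discrete integration of g^(j+1) - g^j. The factor 1 + g^M
dominates every intermediate g^j, whether g is below or above 1. -/
lemma pow_le_second_order {g : ℝ} (hg : 0 < g) (M : ℕ) :
    g ^ M ≤ 1 + M * (g - 1) + M ^ 2 * ((g - 1) ^ 2 * (1 + g ^ M)) := by
  set G := 1 + g ^ M with hG
  have hG0 : 0 < G := by positivity
  have hd : 0 ≤ (g - 1) ^ 2 * G := by positivity
  have key : ∀ j : ℕ, j ≤ M → (g ^ j - 1) * (g - 1) ≤ j * ((g - 1) ^ 2 * G) := by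
    intro j
    induction j with
    | zero => simp
    | succ j ih =>
      intro hj
      have h1 := ih (by omega)
      have h2 : (g - 1) ^ 2 * g ^ j ≤ (g - 1) ^ 2 * G :=
        mul_le_mul_of_nonneg_left (pow_le_one_add_pow hg (by omega)) (sq_nonneg _)
      push_cast
      rw [pow_succ]
      linarith
  have main : ∀ j : ℕ, j ≤ M → g ^ j ≤ 1 + j * (g - 1) + j ^ 2 * ((g - 1) ^ 2 * G) := by
    intro j
    induction j with
    | zero => simp
    | succ j ih =>
      intro hj
      have h1 := ih (by omega)
      have h2 := key j (by omega)
      have h3 : 0 ≤ (j : ℝ) * ((g - 1) ^ 2 * G) := by positivity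
      push_cast
      rw [pow_succ]
      nlinarith
  exact main M le_rfl

/-- The linear term is kept exact because it integrates to zero for y = e^L. Bounding the whole
power by `inv_mixture_le_exp` would leave an exponent of first order in q; that cruder bound serves
only inside the remainder. -/
lemma inv_mixture_pow_le {q y : ℝ} (hq0 : 0 ≤ q) (hq1 : q ≤ 1) (hy : 0 < y) (M : ℕ) :
    ((1 - q + q * y)⁻¹) ^ M ≤ 1 - M * q * (y - 1)
      + 3 * M ^ 2 * q ^ 2 * ((y - 1) ^ 2 * (1 + ((1 - q + q * y)⁻¹) ^ (M + 2))) := by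
  have hh := one_sub_add_mul_pos hq0 hq1 hy
  set g := (1 - q + q * y)⁻¹ with hgdef
  have hg : 0 < g := inv_pos.2 hh
  have hgh : g * (1 + q * (y - 1)) = 1 := by
    rw [show 1 + q * (y - 1) = 1 - q + q * y by ring]
    exact inv_mul_cancel₀ hh.ne'
  have h1 : g - 1 = -(q * (y - 1) * g) := by linear_combination hgh
  have h2 : g - 1 = -(q * (y - 1)) + q ^ 2 * (y - 1) ^ 2 * g := by
    linear_combination (1 - q * (y - 1)) * hgh
  have h3 := pow_le_second_order hg M
  have h4 : (g - 1) ^ 2 * (1 + g ^ M) = q ^ 2 * (y - 1) ^ 2 * (g ^ 2 + g ^ (M + 2)) := by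
    rw [h1]; ring
  rw [h4, h2] at h3
  have h5 : g ≤ 1 + g ^ (M + 2) := by
    simpa using pow_le_one_add_pow hg (j := 1) (N := M + 2) (by omega)
  have h6 : g ^ 2 ≤ 1 + g ^ (M + 2) := pow_le_one_add_pow hg (by omega)
  have hM : (M : ℝ) ≤ (M : ℝ) ^ 2 := by exact_mod_cast Nat.le_self_pow two_ne_zero M
  have hX : 0 ≤ q ^ 2 * (y - 1) ^ 2 := by positivity
  set G := 1 + g ^ (M + 2) with hG
  have h7 : (M : ℝ) * g ≤ (M : ℝ) ^ 2 * G := mul_le_mul hM h5 hg.le (by positivity)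
  have h8 : (M : ℝ) ^ 2 * (g ^ 2 + g ^ (M + 2)) ≤ (M : ℝ) ^ 2 * (2 * G) :=
    mul_le_mul_of_nonneg_left (by linarith) (by positivity)
  have h9 := mul_le_mul_of_nonneg_left (add_le_add h7 h8) hX
  linarith

lemma inv_mixture_le_exp {q t : ℝ} (hq0 : 0 ≤ q) (hq1 : q ≤ 1) :
    (1 - q + q * Real.exp t)⁻¹ ≤ Real.exp (-(q * t)) := by
  rw [Real.exp_neg]
  apply inv_anti₀ (Real.exp_pos _)
  have := (convexOn_exp).2 (Set.mem_univ (0:ℝ)) (Set.mem_univ t)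
    (by linarith : 0 ≤ 1 - q) hq0 (by ring)
  simpa using this

/-- The left side is the expectation of (e^L - 1)² e^(-κL). With r = e^(-κx) it is a common factor
times (1 - r)² + r²(e^x - 1), where 1 - r ≤ κx. -/
lemma second_moment_bound {κ x : ℝ} (hκ : 0 ≤ κ) (hx0 : 0 ≤ x) (hx1 : x ≤ 1) (hκx : κ * x ≤ 1) :
    Real.exp ((2 - κ) * (2 - κ - 1) / 2 * x) - 2 * Real.exp ((1 - κ) * (1 - κ - 1) / 2 * x)
      + Real.exp ((-κ) * (-κ - 1) / 2 * x)
      ≤ 2 * Real.exp (κ ^ 2 * x / 2) * (2 * x + κ ^ 2 * x * x) := by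
  have e1 : Real.exp ((2 - κ) * (2 - κ - 1) / 2 * x)
      = Real.exp ((-κ) * (-κ - 1) / 2 * x) * (Real.exp (-(κ * x)) ^ 2 * Real.exp x) := by
    rw [← Real.exp_nat_mul, ← Real.exp_add, ← Real.exp_add]; push_cast; ring_nf
  have e2 : Real.exp ((1 - κ) * (1 - κ - 1) / 2 * x)
      = Real.exp ((-κ) * (-κ - 1) / 2 * x) * Real.exp (-(κ * x)) := by
    rw [← Real.exp_add]; ring_nf
  have e3 : Real.exp ((-κ) * (-κ - 1) / 2 * x) ≤ 2 * Real.exp (κ ^ 2 * x / 2) := by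
    have : (-κ) * (-κ - 1) / 2 * x = κ * x / 2 + κ ^ 2 * x / 2 := by ring
    rw [this, Real.exp_add]
    gcongr
    have hκx0 : 0 ≤ κ * x := by positivity
    have := exp_sub_one_le_two_mul (y := κ * x / 2) (by linarith) (by linarith)
    linarith
  rw [e1, e2]
  set r := Real.exp (-(κ * x)) with hr
  have hκx0 : 0 ≤ κ * x := by positivity
  have hr0 : 0 < r := Real.exp_pos _
  have hr1 : r ≤ 1 := Real.exp_le_one_iff.2 (by linarith)
  have hr2 : 1 - r ≤ κ * x := by have := Real.add_one_le_exp (-(κ * x)); linarith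
  have h1 : r ^ 2 * Real.exp x - 2 * r + 1 ≤ 2 * x + κ ^ 2 * x * x := by
    have a1 := exp_sub_one_le_two_mul hx0 hx1
    have a2 : r ^ 2 * (Real.exp x - 1) ≤ 1 * (2 * x) :=
      mul_le_mul (pow_le_one₀ hr0.le hr1) a1 (by linarith [Real.add_one_le_exp x]) one_pos.le
    have a3 : (1 - r) ^ 2 ≤ (κ * x) ^ 2 := pow_le_pow_left₀ (by linarith) hr2 2
    nlinarith
  have h2 : 0 ≤ 2 * x + κ ^ 2 * x * x := by positivity
  calc _ = Real.exp ((-κ) * (-κ - 1) / 2 * x) * (r ^ 2 * Real.exp x - 2 * r + 1) := by ring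
    _ ≤ Real.exp ((-κ) * (-κ - 1) / 2 * x) * (2 * x + κ ^ 2 * x * x) := by gcongr
    _ ≤ _ := by gcongr

lemma lintegral_inv_mixRatio_pow_le {τ q : ℝ} (hτ : τ ≠ 0) (hq0 : 0 ≤ q) (hq1 : q ≤ 1)
    (v : EuclideanSpace ℝ ι) (M : ℕ) (h : 2 * ((M : ℝ) + 2) * (‖v‖ ^ 2 / τ ^ 2) ≤ 1) :
    ∫⁻ z, ENNReal.ofReal ((mixRatio τ q v z)⁻¹ ^ M) ∂(isoGaussian ι τ)
      ≤ ENNReal.ofReal (Real.exp (19 * (q ^ 2 * (M + 2) ^ 2 * (‖v‖ ^ 2 / τ ^ 2)))) := by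
  set x := ‖v‖ ^ 2 / τ ^ 2 with hx
  have hx0 : 0 ≤ x := by positivity
  have hMx : 0 ≤ (M : ℝ) * x := by positivity
  -- By convexity, the inverse mixture to the power M + 2 is at most e^(-κL).
  set κ : ℝ := q * (M + 2) with hκ
  have hκ0 : 0 ≤ κ := by positivity
  have hκx : κ * x ≤ 1 := by
    have : q * (((M : ℝ) + 2) * x) ≤ 1 * (((M : ℝ) + 2) * x) :=
      mul_le_mul_of_nonneg_right hq1 (by positivity)
    rw [hκ]; linarith
  set c : ℝ := 3 * M ^ 2 * q ^ 2 with hc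
  have hc0 : 0 ≤ c := by positivity
  set e : ℝ → EuclideanSpace ℝ ι → ℝ := fun a z => Real.exp (a * shiftLogRatio τ v z) with he
  -- A majorant built only from exponentials of multiples of L, hence with an explicit integral.
  set F : EuclideanSpace ℝ ι → ℝ := fun z => 1 + (M * q - M * q * e 1 z) +
    c * ((e 2 z - 2 * e 1 z + 1) + (e (2 - κ) z - 2 * e (1 - κ) z + e (-κ) z)) with hF
  have hpt : ∀ z, (mixRatio τ q v z)⁻¹ ^ M ≤ F z := by
    intro z
    refine (inv_mixture_pow_le hq0 hq1 (Real.exp_pos _) M).trans ?_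
    have h1 : (1 - q + q * Real.exp (shiftLogRatio τ v z))⁻¹ ^ (M + 2) ≤ e (-κ) z := by
      refine (pow_le_pow_left₀ (inv_pos.2 (mixRatio_pos hq0 hq1 v z)).le
        (inv_mixture_le_exp hq0 hq1) _).trans_eq ?_
      rw [← Real.exp_nat_mul, he, hκ]
      push_cast
      ring_nf
    have h2 : e 1 z = Real.exp (shiftLogRatio τ v z) := by simp [he]
    have h3 : e 2 z = Real.exp (shiftLogRatio τ v z) ^ 2 := by
      rw [← Real.exp_nat_mul]; simp [he]
    have h4 : e (2 - κ) z = Real.exp (shiftLogRatio τ v z) ^ 2 * e (-κ) z := by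
      rw [← Real.exp_nat_mul, he, ← Real.exp_add]; push_cast; ring_nf
    have h5 : e (1 - κ) z = Real.exp (shiftLogRatio τ v z) * e (-κ) z := by
      rw [he, ← Real.exp_add]; ring_nf
    rw [hF]
    simp only [h2, h3, h4, h5]
    set y := Real.exp (shiftLogRatio τ v z)
    have h6 : c * ((y - 1) ^ 2 * (1 + (1 - q + q * y)⁻¹ ^ (M + 2)))
        ≤ c * ((y - 1) ^ 2 * (1 + e (-κ) z)) := by gcongr
    linarith
  have hi : ∀ a, Integrable (e a) (isoGaussian ι τ) := integrable_exp_mul_shiftLogRatio hτ v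
  have hI : ∀ a, ∫ z, e a z ∂(isoGaussian ι τ) = Real.exp (a * (a - 1) / 2 * x) :=
    integral_exp_mul_shiftLogRatio hτ v
  have hFi : Integrable F (isoGaussian ι τ) := by
    rw [hF]
    fun_prop
  have hF0 : ∀ z, 0 ≤ F z := fun z =>
    (pow_nonneg (inv_pos.2 (mixRatio_pos hq0 hq1 v z)).le M).trans (hpt z)
  calc ∫⁻ z, ENNReal.ofReal ((mixRatio τ q v z)⁻¹ ^ M) ∂(isoGaussian ι τ)
      ≤ ∫⁻ z, ENNReal.ofReal (F z) ∂(isoGaussian ι τ) :=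
        lintegral_mono fun z => ENNReal.ofReal_le_ofReal (hpt z)
    _ = ENNReal.ofReal (∫ z, F z ∂(isoGaussian ι τ)) :=
        (ofReal_integral_eq_lintegral_ofReal hFi (ae_of_all _ hF0)).symm
    _ ≤ _ := ENNReal.ofReal_le_ofReal ?_
  have hval : ∫ z, F z ∂(isoGaussian ι τ) = 1 + c * ((Real.exp x - 1) +
      (Real.exp ((2 - κ) * (2 - κ - 1) / 2 * x) - 2 * Real.exp ((1 - κ) * (1 - κ - 1) / 2 * x)
        + Real.exp ((-κ) * (-κ - 1) / 2 * x))) := by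
    have h1 := (hi 1).const_mul (M * q)
    have h2 := (hi 1).const_mul 2
    have h3 := (hi (1 - κ)).const_mul 2
    rw [hF, integral_add (by fun_prop) (by fun_prop), integral_add (by fun_prop) (by fun_prop),
      integral_sub (by fun_prop) (by fun_prop), integral_const_mul (M * q : ℝ),
      integral_const_mul c, integral_add (by fun_prop) (by fun_prop),
      integral_add (by fun_prop) (by fun_prop), integral_add (by fun_prop) (by fun_prop),
      integral_sub (by fun_prop) (by fun_prop),
      integral_sub (by fun_prop) (by fun_prop), integral_const_mul (2 : ℝ) (e 1),
      integral_const_mul (2 : ℝ) (e (1 - κ))]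
    simp only [hI]
    simp
    left
    ring_nf
  rw [hval]
  have hx1 : x ≤ 1 := by linarith
  have hb := second_moment_bound hκ0 hx0 hx1 hκx
  have hb' := exp_sub_one_le_two_mul hx0 hx1
  set u := q ^ 2 * ((M : ℝ) + 2) ^ 2 * x with hu
  have hu0 : 0 ≤ u := by positivity
  have hκu : κ ^ 2 * x = u := by rw [hκ, hu]; ring
  rw [hκu] at hb
  have hcx : c * x ≤ 3 * u := by
    rw [hc, hu]
    have : (M : ℝ) ^ 2 ≤ (M + 2) ^ 2 := by gcongr; linarith
    have := mul_le_mul_of_nonneg_right this (by positivity : 0 ≤ q ^ 2 * x)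
    linarith
  set E := Real.exp (u / 2) with hE
  have hE1 : u / 2 + 1 ≤ E := Real.add_one_le_exp _
  have hEE : E * E = Real.exp u := by rw [hE, ← Real.exp_add]; ring_nf
  -- One unit of the exponent 19u pays for E² = e^u, and the other 18 for the factor 1 + 18u.
  have h19 : Real.exp (19 * u) = Real.exp (18 * u) * (E * E) := by
    rw [hEE, ← Real.exp_add]; ring_nf
  have h18 := Real.add_one_le_exp (18 * u)
  calc _ ≤ 1 + c * (2 * x + 2 * E * (2 * x + u * x)) := by gcongr
    _ = 1 + c * x * (2 + 4 * E * (1 + u / 2)) := by ring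
    _ ≤ 1 + 3 * u * (2 + 4 * E * E) := by
        gcongr
        linarith
    _ ≤ (18 * u + 1) * (E * E) := by
        have h1 : 1 ≤ E * E := by nlinarith
        have h2 := mul_le_mul_of_nonneg_left h1 hu0
        linarith
    _ ≤ Real.exp (19 * u) := by rw [h19]; gcongr

/-- The Rényi-type moment of the likelihood ratio of two Gaussian mixtures with mixing
weight `q`. -/
lemma lintegral_mixRatio_pow_mul_inv_pow_le {τ q y : ℝ} (hτ : τ ≠ 0) (hq0 : 0 ≤ q) (hq1 : q ≤ 1)
    {v v' : EuclideanSpace ℝ ι} (hv : ‖v‖ ^ 2 / τ ^ 2 ≤ y) (hv' : ‖v'‖ ^ 2 / τ ^ 2 ≤ y)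
    (m : ℕ) (h : 4 * ((m : ℝ) + 1) * y ≤ 1) :
    ∫⁻ z, ENNReal.ofReal (mixRatio τ q v z ^ (m + 1) * (mixRatio τ q v' z)⁻¹ ^ m)
        ∂(isoGaussian ι τ)
      ≤ ENNReal.ofReal (Real.exp (76 * (q ^ 2 * (m + 1) ^ 2 * y))) := by
  have hm : (0 : ℝ) ≤ m := by positivity
  -- The inequality 2ab ≤ a² + b² separates the two ratios at the price of doubled exponents. The
  -- constant 76 is 19 · 4, since 2m + 2 = 2(m + 1); the positive moment needs only 8.
  have hpt : ∀ z, ENNReal.ofReal (mixRatio τ q v z ^ (m + 1) * (mixRatio τ q v' z)⁻¹ ^ m)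
      ≤ ENNReal.ofReal (1 / 2) * (ENNReal.ofReal (mixRatio τ q v z ^ (2 * (m + 1)))
        + ENNReal.ofReal ((mixRatio τ q v' z)⁻¹ ^ (2 * m))) := by
    intro z
    have h1 := mixRatio_pos (τ := τ) hq0 hq1 v z
    have h2 := inv_pos.2 (mixRatio_pos (τ := τ) hq0 hq1 v' z)
    rw [← ENNReal.ofReal_add (by positivity) (by positivity), ← ENNReal.ofReal_mul (by norm_num)]
    apply ENNReal.ofReal_le_ofReal
    rw [mul_comm 2 (m + 1), mul_comm 2 m, pow_mul, pow_mul]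
    nlinarith [sq_nonneg (mixRatio τ q v z ^ (m + 1) - (mixRatio τ q v' z)⁻¹ ^ m)]
  refine (lintegral_mono hpt).trans ?_
  rw [lintegral_const_mul _ (by fun_prop), lintegral_add_left (by fun_prop)]
  have p1 := lintegral_mixRatio_pow_le hτ hq0 hq1 v (2 * (m + 1)) (by
    push_cast
    nlinarith)
  have p2 := lintegral_inv_mixRatio_pow_le hτ hq0 hq1 v' (2 * m) (by
    push_cast
    nlinarith)
  have q1 : Real.exp (2 * (q ^ 2 * ((2 * (m + 1) : ℕ) : ℝ) ^ 2 * (‖v‖ ^ 2 / τ ^ 2)))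
      ≤ Real.exp (76 * (q ^ 2 * (m + 1) ^ 2 * y)) := by
    apply Real.exp_le_exp.2
    have := mul_le_mul_of_nonneg_left hv (by positivity : 0 ≤ q ^ 2 * ((m : ℝ) + 1) ^ 2)
    have : 0 ≤ q ^ 2 * ((m : ℝ) + 1) ^ 2 * (‖v‖ ^ 2 / τ ^ 2) := by positivity
    push_cast
    linarith
  have q2 : Real.exp (19 * (q ^ 2 * (((2 * m : ℕ) : ℝ) + 2) ^ 2 * (‖v'‖ ^ 2 / τ ^ 2)))
      ≤ Real.exp (76 * (q ^ 2 * (m + 1) ^ 2 * y)) := by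
    apply Real.exp_le_exp.2
    have := mul_le_mul_of_nonneg_left hv' (by positivity : 0 ≤ q ^ 2 * ((m : ℝ) + 1) ^ 2)
    push_cast
    linarith
  refine (mul_le_mul_right (add_le_add (p1.trans (ENNReal.ofReal_le_ofReal q1))
    (p2.trans (ENNReal.ofReal_le_ofReal q2))) _).trans_eq ?_
  rw [← ENNReal.ofReal_add (by positivity) (by positivity), ← ENNReal.ofReal_mul (by norm_num)]
  congr 1
  ring

end Moments

/-! ### Poisson sampling: isolating the membership of one index. -/

section Bernoulli
open Classical in
lemma sum_set_eq_sum_insert {α M : Type*} [Fintype α] [AddCommMonoid M] (i : α) (F : Set α → M) :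
    ∑ S, F S = ∑ S with i ∉ S, (F S + F (insert i S)) := by
  rw [Finset.sum_add_distrib, ← Finset.sum_filter_add_sum_filter_not Finset.univ (fun S => i ∉ S)]
  congr 1
  refine Finset.sum_nbij' (fun S => S \ {i}) (fun S => insert i S) ?_ ?_ ?_ ?_ ?_
  · simp
  · simp
  · intro S hS
    simp only [Finset.mem_filter, not_not] at hS
    simp [Set.insert_eq_of_mem hS.2]
  · intro S hS
    simp only [Finset.mem_filter] at hS
    simp [hS.2]
  · intro S hS
    simp only [Finset.mem_filter, not_not] at hS
    simp [Set.insert_eq_of_mem hS.2]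

/-- The two product probabilities differ only in the factor of the index `i`; `a` is the product
over the other indices. -/
lemma setBernoulli_singleton_pair {n : ℕ} (q : unitInterval) {i : Fin n} {S : Set (Fin n)}
    (hi : i ∉ S) : ∃ a : ENNReal,
      setBernoulli Set.univ q {S} = a * ENNReal.ofReal (1 - q) ∧
      setBernoulli Set.univ q {insert i S} = a * ENNReal.ofReal q := by
  have e1 : ((unitInterval.toNNReal q : NNReal) : ENNReal) = ENNReal.ofReal q := by
    rw [ENNReal.ofReal]; congr 1; ext; simp [q.2.1]
  have e2 : ((unitInterval.toNNReal (unitInterval.symm q) : NNReal) : ENNReal)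
      = ENNReal.ofReal (1 - q) := by
    rw [ENNReal.ofReal]; congr 1; ext; simp [q.2.2]
  have hf : (Set.univ : Set (Fin n)).Finite := Set.finite_univ
  have h1 : (insert i S).ncard = S.ncard + 1 := Set.ncard_insert_of_notMem hi
  have h2 : (Set.univ \ S).ncard = (Set.univ \ insert i S).ncard + 1 := by
    rw [← Set.ncard_insert_of_notMem (a := i) (by simp)]
    congr 1
    ext j
    by_cases h : j = i <;> simp [h, hi]
  refine ⟨ENNReal.ofReal q ^ S.ncard * ENNReal.ofReal (1 - q) ^ (Set.univ \ insert i S).ncard,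
    ?_, ?_⟩
  · rw [setBernoulli_singleton q (Set.subset_univ _) hf, e1, e2, h2, pow_succ, mul_assoc]
  · rw [setBernoulli_singleton q (Set.subset_univ _) hf, e1, e2, h1, pow_succ]
    ring

/-- Resampling the membership of one index does not change the law of a Bernoulli random set. -/
lemma lintegral_setBernoulli_resample {n : ℕ} (q : unitInterval) (i : Fin n)
    (f : Set (Fin n) → ENNReal) :
    ∫⁻ S, f S ∂(setBernoulli Set.univ q)
      = ∫⁻ S, (ENNReal.ofReal (1 - q) * f (S \ {i}) + ENNReal.ofReal q * f (insert i S))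
        ∂(setBernoulli Set.univ q) := by
  classical
  rw [lintegral_fintype, lintegral_fintype, sum_set_eq_sum_insert i, sum_set_eq_sum_insert i]
  refine Finset.sum_congr rfl fun S hS => ?_
  simp only [Finset.mem_filter] at hS
  obtain ⟨a, h1, h2⟩ := setBernoulli_singleton_pair q hS.2
  have h3 : insert i S \ {i} = S := by simp [hS.2]
  have h4 : S \ {i} = S := by simp [hS.2]
  have h5 : ENNReal.ofReal (1 - q) + ENNReal.ofReal q = 1 := by
    rw [← ENNReal.ofReal_add (by linarith [q.2.2]) q.2.1]; simp
  rw [h1, h2, h3, h4, Set.insert_idem]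
  calc _ = a * (ENNReal.ofReal (1 - q) * f S + ENNReal.ofReal q * f (insert i S)) * 1 := by ring
    _ = _ := by rw [← h5]; ring
end Bernoulli

/-! ### Likelihood ratios of the iterates and composition over steps. -/

section Mechanism
variable {n c d T : ℕ} (lam μ ς : ℝ) (b : Fin c → ℝ) (B R σ : ℝ) (q : unitInterval)

@[fun_prop]
lemma measurable_exampleGradient (s : Sample c d) :
    Measurable (exampleGradient lam μ ς b s) := by
  have h : ∀ k, Measurable fun w : Weights c d => classWeight w k := by
    intro k; unfold classWeight; fun_prop
  have hm : ∀ k, Measurable fun w : Weights c d => margin b w s k := by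
    intro k
    have := h k
    have := h s.2
    unfold margin; fun_prop
  have hs : ∀ k, Measurable fun w : Weights c d => hingeSlope ς (margin b w s k) := by
    intro k
    have := hm k
    unfold hingeSlope; fun_prop
  have hg : ∀ k, Measurable fun w : Weights c d => gradBlock lam μ ς b s w k := by
    intro k
    unfold gradBlock
    split_ifs <;> fun_prop
  unfold exampleGradient
  refine (WithLp.measurable_toLp 2 _).comp (measurable_pi_iff.2 fun p => ?_)
  have := hg p.1
  fun_prop

@[fun_prop]
lemma measurable_clippedGradient (s : Option (Sample c d)) :
    Measurable fun w => clippedGradient lam μ ς b R w s := by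
  cases s with
  | none => exact measurable_const
  | some s => simp only [clippedGradient, clip]; fun_prop

lemma norm_clip_le {E : Type*} [NormedAddCommGroup E] [NormedSpace ℝ E] {R : ℝ} (hR : 0 < R)
    (v : E) : ‖clip R v‖ ≤ R := by
  have hpos : 0 < max 1 (‖v‖ / R) := lt_max_of_lt_left one_pos
  rw [clip, norm_smul, norm_inv, Real.norm_of_nonneg hpos.le, inv_mul_le_iff₀ hpos,
    ← div_le_iff₀ hR]
  exact le_max_right _ _

lemma norm_clippedGradient_le {R : ℝ} (hR : 0 < R) (w : Weights c d) (s : Option (Sample c d)) :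
    ‖clippedGradient lam μ ς b R w s‖ ≤ R := by
  cases s with
  | none => simpa [clippedGradient] using hR.le
  | some s => exact norm_clip_le hR _

@[fun_prop]
lemma measurable_gdStep (η : ℝ) (D : Dataset n c d) {α : Type*} [MeasurableSpace α]
    {f : α → StepNoise n c d} {g : α → Weights c d} (hf : Measurable f) (hg : Measurable g) :
    Measurable fun a => gdStep lam μ ς b B R η D (f a) (g a) := by
  classical
  have : Measurable fun p : Set (Fin n) × (Weights c d × Weights c d) =>
      gdStep lam μ ς b B R η D (p.1, p.2.1) p.2.2 := by
    refine measurable_from_prod_countable_right fun S => ?_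
    have h : Measurable fun y : Weights c d × Weights c d => ∑ j,
        if j ∈ S then clippedGradient lam μ ς b R y.2 (D j) else 0 :=
      Finset.measurable_sum _ fun j _ => by split_ifs <;> fun_prop
    simp only [gdStep, Finset.sum_filter]
    fun_prop
  exact this.comp (f := fun a => ((f a).1, ((f a).2, g a))) (by fun_prop)

/-- The displacement of the noise that a single example causes when it is in the mini-batch. -/
def exampleShift (s : Option (Sample c d)) (w : Weights c d) : Weights c d :=
  (1 / B) • clippedGradient lam μ ς b R w s

@[fun_prop]
lemma measurable_exampleShift (s : Option (Sample c d)) :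
    Measurable (exampleShift lam μ ς b B R s) := by
  unfold exampleShift; fun_prop

lemma gdStep_sdiff (η : ℝ) (D : Dataset n c d) (i : Fin n) (S : Set (Fin n)) (z w : Weights c d) :
    gdStep lam μ ς b B R η D (S \ {i}, z) w
      = gdStep lam μ ς b B R η (Function.update D i none) (S, z) w := by
  classical
  simp only [gdStep, Finset.sum_filter]
  congr 4
  refine Finset.sum_congr rfl fun j _ => ?_
  by_cases h : j = i
  · subst h; simp [clippedGradient]
  · simp [h]

/-- Including `i` in the mini-batch acts like extra noise on the data set without it, so `i`
influences the step only through a noise shift. -/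
lemma gdStep_insert (η : ℝ) (D : Dataset n c d) (i : Fin n) (S : Set (Fin n)) (z w : Weights c d) :
    gdStep lam μ ς b B R η D (insert i S, z) w
      = gdStep lam μ ς b B R η (Function.update D i none)
          (S, z + exampleShift lam μ ς b B R (D i) w) w := by
  classical
  simp only [gdStep, exampleShift, Finset.sum_filter]
  rw [← add_assoc, add_right_comm, ← smul_add]
  congr 4
  rw [← Finset.add_sum_erase _ _ (Finset.mem_univ i),
    ← Finset.add_sum_erase (f := fun a => if a ∈ S then _ else _) _ (Finset.mem_univ i)]
  simp only [Set.mem_insert_iff, true_or, if_true, Function.update_self, clippedGradient, ite_self,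
    zero_add]
  rw [add_comm]
  congr 1
  refine Finset.sum_congr rfl fun j hj => ?_
  simp [Finset.ne_of_mem_erase hj]

/-- The law of the randomness of one step. -/
abbrev stepLaw (n c d : ℕ) (q : unitInterval) (R σ : ℝ) : Measure (StepNoise n c d) :=
  (setBernoulli (Set.univ : Set (Fin n)) q).prod (isoGaussian (Fin c × Fin d) (R * σ))

lemma noiseLaw_eq_pi : noiseLaw n c d T q R σ = Measure.pi fun _ => stepLaw n c d q R σ := by
  rw [noiseLaw, ← mul_pow]

instance : IsProbabilityMeasure (noiseLaw n c d T q R σ) := by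
  rw [noiseLaw_eq_pi]; infer_instance

/-- One step on a data set is one step without the example `i`, reweighted by the likelihood
ratio of a Gaussian mixture. -/
lemma lintegral_gdStep (hτ : R * σ ≠ 0) (η : ℝ) (D : Dataset n c d) (i : Fin n) (w : Weights c d)
    {G : Weights c d → ENNReal} (hG : Measurable G) :
    ∫⁻ ω, G (gdStep lam μ ς b B R η D ω w) ∂(stepLaw n c d q R σ)
      = ∫⁻ ω, ENNReal.ofReal (mixRatio (R * σ) q (exampleShift lam μ ς b B R (D i) w) ω.2) *
          G (gdStep lam μ ς b B R η (Function.update D i none) ω w) ∂(stepLaw n c d q R σ) := by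
  have hq := q.2
  rw [lintegral_prod _ (by fun_prop), lintegral_prod _ (by fun_prop),
    lintegral_setBernoulli_resample q i]
  refine lintegral_congr fun S => ?_
  simp only [gdStep_sdiff, gdStep_insert]
  set v := exampleShift lam μ ς b B R (D i) w
  rw [lintegral_multivariateGaussian_add hτ v
    (f := fun z => G (gdStep lam μ ς b B R η (Function.update D i none) (S, z) w)) (by fun_prop),
    ← lintegral_const_mul _ (by fun_prop), ← lintegral_const_mul _ (by fun_prop),
    ← lintegral_add_left (by fun_prop)]
  refine lintegral_congr fun z => ?_
  rw [← mul_assoc, ← ENNReal.ofReal_mul hq.1, ← add_mul,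
    ← ENNReal.ofReal_add (by linarith [hq.2]) (mul_nonneg hq.1 (Real.exp_pos _).le)]
  rfl

/-- The recursion defining the iterates peels off the last step; inductions over a varying starting
weight need the first. -/
lemma iterates_succ (η : Fin (T + 1) → ℝ) (w₀ : Weights c d) (D : Dataset n c d)
    (ω : Fin (T + 1) → StepNoise n c d) :
    iterates lam μ ς b B R η w₀ D ω
      = Fin.cons w₀ (iterates lam μ ς b B R (Fin.tail η)
          (gdStep lam μ ς b B R (η 0) D (ω 0) w₀) D (Fin.tail ω)) := by
  funext j
  refine Fin.cases rfl (fun j => ?_) j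
  rw [Fin.cons_succ]
  induction j using Fin.induction with
  | zero => rfl
  | succ j ih =>
    unfold iterates at ih ⊢
    rw [Fin.induction_succ, Fin.induction_succ, ← ih]
    rfl

@[fun_prop]
lemma measurable_iterates (η : Fin T → ℝ) (D : Dataset n c d) {α : Type*} [MeasurableSpace α]
    {f : α → Fin T → StepNoise n c d} {g : α → Weights c d} (hf : Measurable f)
    (hg : Measurable g) :
    Measurable fun a => iterates lam μ ς b B R η (g a) D (f a) := by
  refine measurable_pi_iff.2 fun j => ?_
  induction j using Fin.induction with
  | zero => exact hg
  | succ j ih =>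
    simp only [iterates, Fin.induction_succ] at ih ⊢
    exact measurable_gdStep _ _ _ _ _ _ _ _ (by fun_prop) ih

/-- The product of the likelihood ratios of all steps, where `V w` is the displacement of the noise
at the weight `w`. -/
def traceRatio (V : Weights c d → Weights c d) (η : Fin T → ℝ) (w₀ : Weights c d)
    (D : Dataset n c d) (ω : Fin T → StepNoise n c d) : ℝ :=
  ∏ t, mixRatio (R * σ) q (V (iterates lam μ ς b B R η w₀ D ω t.castSucc)) (ω t).2

lemma traceRatio_succ (V : Weights c d → Weights c d) (η : Fin (T + 1) → ℝ) (w₀ : Weights c d)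
    (D : Dataset n c d) (ω : Fin (T + 1) → StepNoise n c d) :
    traceRatio lam μ ς b B R σ q V η w₀ D ω = mixRatio (R * σ) q (V w₀) (ω 0).2 *
      traceRatio lam μ ς b B R σ q V (Fin.tail η) (gdStep lam μ ς b B R (η 0) D (ω 0) w₀) D
        (Fin.tail ω) := by
  rw [traceRatio, Fin.prod_univ_succ, traceRatio, iterates_succ]
  rfl

lemma traceRatio_pos (V : Weights c d → Weights c d) (η : Fin T → ℝ) (w₀ : Weights c d)
    (D : Dataset n c d) (ω : Fin T → StepNoise n c d) :
    0 < traceRatio lam μ ς b B R σ q V η w₀ D ω :=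
  Finset.prod_pos fun _ _ => mixRatio_pos q.2.1 q.2.2 _ _

@[fun_prop]
lemma measurable_traceRatio {V : Weights c d → Weights c d} (hV : Measurable V) (η : Fin T → ℝ)
    (D : Dataset n c d) {α : Type*} [MeasurableSpace α] {f : α → Fin T → StepNoise n c d}
    {g : α → Weights c d} (hf : Measurable f) (hg : Measurable g) :
    Measurable fun a => traceRatio lam μ ς b B R σ q V η (g a) D (f a) := by
  unfold traceRatio; fun_prop

lemma lintegral_noiseLaw_succ {F : (Fin (T + 1) → StepNoise n c d) → ENNReal} (hF : Measurable F) :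
    ∫⁻ ω, F ω ∂(noiseLaw n c d (T + 1) q R σ)
      = ∫⁻ ω₀, ∫⁻ ω, F (Fin.cons ω₀ ω) ∂(noiseLaw n c d T q R σ) ∂(stepLaw n c d q R σ) := by
  have h := (measurePreserving_piFinSuccAbove
    (fun _ : Fin (T + 1) => stepLaw n c d q R σ) 0).symm
  rw [noiseLaw_eq_pi, noiseLaw_eq_pi, ← h.lintegral_comp hF, lintegral_prod]
  · simp [MeasurableEquiv.piFinSuccAbove]
    rfl
  · exact (hF.comp (MeasurableEquiv.measurable _)).aemeasurable

/-- Induction on T: the first step is reweighted with the expectation over all later steps as test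
function, and the induction hypothesis applies from the updated weight. -/
lemma lintegral_iterates (hτ : R * σ ≠ 0) (D : Dataset n c d) (i : Fin n) :
    ∀ {T : ℕ} (η : Fin T → ℝ) (w₀ : Weights c d) {G : (Fin (T + 1) → Weights c d) → ENNReal},
    Measurable G →
    ∫⁻ ω, G (iterates lam μ ς b B R η w₀ D ω) ∂(noiseLaw n c d T q R σ)
      = ∫⁻ ω, ENNReal.ofReal (traceRatio lam μ ς b B R σ q (exampleShift lam μ ς b B R (D i)) η w₀
            (Function.update D i none) ω) *
          G (iterates lam μ ς b B R η w₀ (Function.update D i none) ω)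
          ∂(noiseLaw n c d T q R σ) := by
  intro T
  induction T with
  | zero =>
    intro η w₀ G hG
    refine lintegral_congr fun ω => ?_
    have : iterates lam μ ς b B R η w₀ D ω
        = iterates lam μ ς b B R η w₀ (Function.update D i none) ω := by
      funext j
      exact Fin.cases rfl (fun j => j.elim0) j
    simp [traceRatio, this]
  | succ T ih =>
    intro η w₀ G hG
    have hcons : Measurable fun u : Fin (T + 1) → Weights c d =>
        (Fin.cons w₀ u : Fin (T + 2) → Weights c d) :=
      measurable_pi_iff.2 (Fin.forall_fin_succ.2 ⟨by simp, fun j => by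
        simpa using measurable_pi_apply j⟩)
    have hG' : Measurable fun u : Fin (T + 1) → Weights c d => G (Fin.cons w₀ u) := hG.comp hcons
    rw [lintegral_noiseLaw_succ _ _ _ (by fun_prop), lintegral_noiseLaw_succ _ _ _ (by fun_prop)]
    simp only [iterates_succ, traceRatio_succ, Fin.cons_zero, Fin.tail_cons]
    rw [lintegral_gdStep lam μ ς b B R σ q hτ (η 0) D i w₀
      (G := fun w => ∫⁻ ω, G (Fin.cons w₀ (iterates lam μ ς b B R (Fin.tail η) w D ω))
        ∂(noiseLaw n c d T q R σ))]
    · refine lintegral_congr fun ω₀ => ?_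
      rw [ih (Fin.tail η) (gdStep lam μ ς b B R (η 0) (Function.update D i none) ω₀ w₀) hG',
        ← lintegral_const_mul]
      · refine lintegral_congr fun ω => ?_
        rw [ENNReal.ofReal_mul (mixRatio_pos q.2.1 q.2.2 _ _).le, mul_assoc]
      · fun_prop
    · refine Measurable.lintegral_prod_right'
        (f := fun p : Weights c d × (Fin T → StepNoise n c d) =>
        G (Fin.cons w₀ (iterates lam μ ς b B R (Fin.tail η) p.1 D p.2))) ?_
      exact hG'.comp (by fun_prop)

/-- Adaptive composition: given the first step, the remaining moment is at most `A ^ T` from any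
starting weight, so it can be pulled out. -/
lemma lintegral_traceRatio_moment_le {V V' : Weights c d → Weights c d} (hV : Measurable V)
    (hV' : Measurable V') (D : Dataset n c d) (m : ℕ) {A : ENNReal}
    (hA : ∀ w, ∫⁻ z, ENNReal.ofReal (mixRatio (R * σ) q (V w) z ^ (m + 1) *
        (mixRatio (R * σ) q (V' w) z)⁻¹ ^ m) ∂(isoGaussian (Fin c × Fin d) (R * σ)) ≤ A) :
    ∀ {T : ℕ} (η : Fin T → ℝ) (w₀ : Weights c d),
    ∫⁻ ω, ENNReal.ofReal (traceRatio lam μ ς b B R σ q V η w₀ D ω ^ (m + 1) *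
        (traceRatio lam μ ς b B R σ q V' η w₀ D ω)⁻¹ ^ m) ∂(noiseLaw n c d T q R σ) ≤ A ^ T := by
  intro T
  induction T with
  | zero => intro η w₀; simp [traceRatio]
  | succ T ih =>
    intro η w₀
    rw [lintegral_noiseLaw_succ _ _ _ (by fun_prop)]
    simp only [traceRatio_succ, Fin.cons_zero, Fin.tail_cons]
    calc _ ≤ ∫⁻ ω₀ : StepNoise n c d, ENNReal.ofReal (mixRatio (R * σ) q (V w₀) ω₀.2 ^ (m + 1) *
          (mixRatio (R * σ) q (V' w₀) ω₀.2)⁻¹ ^ m) * A ^ T ∂(stepLaw n c d q R σ) := by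
          refine lintegral_mono fun ω₀ => ?_
          have h1 := mixRatio_pos (τ := R * σ) q.2.1 q.2.2 (V w₀) ω₀.2
          have h2 := inv_pos.2 (mixRatio_pos (τ := R * σ) q.2.1 q.2.2 (V' w₀) ω₀.2)
          refine le_trans (le_of_eq ?_) (mul_le_mul_right
            (ih (Fin.tail η) (gdStep lam μ ς b B R (η 0) D ω₀ w₀)) _)
          rw [← lintegral_const_mul _ (by fun_prop)]
          refine lintegral_congr fun ω => ?_
          rw [← ENNReal.ofReal_mul (by positivity)]
          congr 1
          rw [mul_inv, mul_pow, mul_pow]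
          ring
      _ ≤ A * A ^ T := by
          rw [lintegral_mul_const _ (by fun_prop), lintegral_prod _ (by fun_prop)]
          gcongr
          simp only [lintegral_const, measure_univ, mul_one]
          exact hA w₀
      _ = A ^ (T + 1) := by rw [pow_succ, mul_comm]

/-- The tail estimate that turns a moment of a likelihood ratio into differential privacy. -/
lemma le_exp_mul_add_moment {r r' ε : ℝ} (hr : 0 < r) (hr' : 0 < r') (m : ℕ) :
    r ≤ Real.exp ε * r' + Real.exp (-(m * ε)) * (r ^ (m + 1) * r'⁻¹ ^ m) := by
  rcases le_total r (Real.exp ε * r') with h | h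
  · have : 0 ≤ Real.exp (-(m * ε)) * (r ^ (m + 1) * r'⁻¹ ^ m) := by positivity
    linarith
  · have h1 : 1 ≤ Real.exp (-ε) * (r * r'⁻¹) := by
      rw [Real.exp_neg, ← div_eq_mul_inv, inv_mul_eq_div, le_div_iff₀ (Real.exp_pos _), one_mul,
        le_div_iff₀ hr']
      exact h
    have h2 := mul_le_mul_of_nonneg_left (one_le_pow₀ h1 (n := m)) hr.le
    have h3 : r * (Real.exp (-ε) * (r * r'⁻¹)) ^ m
        = Real.exp (-(m * ε)) * (r ^ (m + 1) * r'⁻¹ ^ m) := by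
      rw [mul_pow, mul_pow, ← Real.exp_nat_mul]
      ring_nf
    have : 0 < Real.exp ε * r' := by positivity
    linarith

lemma isDP_iterates_of_moment (hτ : R * σ ≠ 0) (η : Fin T → ℝ) (w₀ : Weights c d) {ε δ : ℝ}
    (m : ℕ) {A : ENNReal}
    (hA : ∀ (s s' : Option (Sample c d)) (w : Weights c d),
      ∫⁻ z, ENNReal.ofReal (mixRatio (R * σ) q (exampleShift lam μ ς b B R s w) z ^ (m + 1) *
        (mixRatio (R * σ) q (exampleShift lam μ ς b B R s' w) z)⁻¹ ^ m)
        ∂(isoGaussian (Fin c × Fin d) (R * σ)) ≤ A)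
    (hδ : ENNReal.ofReal (Real.exp (-(m * ε))) * A ^ T ≤ ENNReal.ofReal δ) :
    IsDP Neighbors (noiseLaw n c d T q R σ) (iterates lam μ ς b B R η w₀) ε δ := by
  rintro D D' ⟨i, -, hD⟩ O hO
  have hbase : Function.update D' i none = Function.update D i none := by
    funext j
    by_cases h : j = i
    · subst h; simp
    · simp [h, hD j h]
  have hprob : ∀ D : Dataset n c d,
      noiseLaw n c d T q R σ {ω | iterates lam μ ς b B R η w₀ D ω ∈ O}
        = ∫⁻ ω in {ω | iterates lam μ ς b B R η w₀ (Function.update D i none) ω ∈ O},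
          ENNReal.ofReal (traceRatio lam μ ς b B R σ q (exampleShift lam μ ς b B R (D i)) η w₀
            (Function.update D i none) ω) ∂(noiseLaw n c d T q R σ) := by
    intro D
    have hmeas : ∀ D : Dataset n c d,
        MeasurableSet {ω | iterates (T := T) lam μ ς b B R η w₀ D ω ∈ O} := fun D =>
      (show Measurable fun ω => iterates (T := T) lam μ ς b B R η w₀ D ω by fun_prop) hO
    have h := lintegral_iterates lam μ ς b B R σ q hτ D i η w₀
      (G := O.indicator 1) (measurable_one.indicator hO)
    rw [← lintegral_indicator_one (hmeas D), ← lintegral_indicator (hmeas _)]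
    refine Eq.trans ?_ (h.trans ?_)
    · exact lintegral_congr fun ω => rfl
    · refine lintegral_congr fun ω => ?_
      by_cases h : iterates lam μ ς b B R η w₀ (Function.update D i none) ω ∈ O <;> simp [h]
  rw [hprob D, hprob D', hbase]
  set D₀ := Function.update D i none
  set Q := {ω | iterates lam μ ς b B R η w₀ D₀ ω ∈ O}
  set ρ := traceRatio lam μ ς b B R σ q (exampleShift lam μ ς b B R (D i)) η w₀ D₀ with hρ
  set ρ' := traceRatio lam μ ς b B R σ q (exampleShift lam μ ς b B R (D' i)) η w₀ D₀ with hρ'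
  have hm : Measurable ρ := by rw [hρ]; fun_prop
  have hm' : Measurable ρ' := by rw [hρ']; fun_prop
  have hpos : ∀ ω, 0 < ρ ω := fun ω => traceRatio_pos ..
  have hpos' : ∀ ω, 0 < ρ' ω := fun ω => traceRatio_pos ..
  calc ∫⁻ ω in Q, ENNReal.ofReal (ρ ω) ∂(noiseLaw n c d T q R σ)
      ≤ ∫⁻ ω in Q, (ENNReal.ofReal (Real.exp ε) * ENNReal.ofReal (ρ' ω) +
          ENNReal.ofReal (Real.exp (-(m * ε))) *
            ENNReal.ofReal (ρ ω ^ (m + 1) * (ρ' ω)⁻¹ ^ m)) ∂(noiseLaw n c d T q R σ) := by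
        refine lintegral_mono fun ω => ?_
        have h1 := hpos ω
        have h2 := hpos' ω
        rw [← ENNReal.ofReal_mul (Real.exp_pos _).le, ← ENNReal.ofReal_mul (Real.exp_pos _).le,
          ← ENNReal.ofReal_add (by positivity) (by positivity)]
        exact ENNReal.ofReal_le_ofReal (le_exp_mul_add_moment h1 h2 m)
    _ = ENNReal.ofReal (Real.exp ε) * ∫⁻ ω in Q, ENNReal.ofReal (ρ' ω) ∂(noiseLaw n c d T q R σ) +
          ENNReal.ofReal (Real.exp (-(m * ε))) *
            ∫⁻ ω in Q, ENNReal.ofReal (ρ ω ^ (m + 1) * (ρ' ω)⁻¹ ^ m) ∂(noiseLaw n c d T q R σ) := by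
        rw [lintegral_add_left (by fun_prop), lintegral_const_mul _ (by fun_prop),
          lintegral_const_mul _ (by fun_prop)]
    _ ≤ _ := by
        refine add_le_add le_rfl (le_trans ?_ hδ)
        gcongr
        exact (setLIntegral_le_lintegral _ _).trans
          (lintegral_traceRatio_moment_le lam μ ς b B R σ q (by fun_prop) (by fun_prop) D₀ m
            (fun w => hA (D i) (D' i) w) η w₀)

/-- Post-processing: an event for the last iterate is an event for the trajectory. -/
lemma isDP_finalWeight {η : Fin T → ℝ} {w₀ : Weights c d} {ε δ : ℝ}
    (h : IsDP Neighbors (noiseLaw n c d T q R σ) (iterates lam μ ς b B R η w₀) ε δ) :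
    IsDP Neighbors (noiseLaw n c d T q R σ) (finalWeight lam μ ς b B R η w₀) ε δ :=
  fun D D' hD O hO => h D D' hD ((fun u => u (Fin.last T)) ⁻¹' O) (measurable_pi_apply _ hO)

end Mechanism

/-! ### The explicit gradient of the objective. -/

section Gradient
variable {c d : ℕ}

/-- The projection of the flattened weight vector to the block of class `k`. -/
def classWeightCLM (k : Fin c) : Weights c d →L[ℝ] EuclideanSpace ℝ (Fin d) :=
  LinearMap.toContinuousLinearMap
    { toFun := fun w => classWeight w k
      map_add' := fun _ _ => rfl
      map_smul' := fun _ _ => rfl }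

@[simp]
lemma classWeightCLM_apply (k : Fin c) (w : Weights c d) :
    classWeightCLM k w = classWeight w k := rfl

lemma hasDerivAt_smoothHinge {ς : ℝ} (hς : 0 < ς) (γ : ℝ) :
    HasDerivAt (smoothHinge ς) (hingeSlope ς γ) γ := by
  have hpos : 0 < γ ^ 2 + ς ^ 2 := by positivity
  have h1 : HasDerivAt (fun γ : ℝ => γ ^ 2 + ς ^ 2) (2 * γ) γ := by
    simpa using (hasDerivAt_pow 2 γ).add_const (ς ^ 2)
  have h := ((hasDerivAt_id γ).add (h1.sqrt hpos.ne')).div_const 2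
  have hs : √(γ ^ 2 + ς ^ 2) ≠ 0 := (Real.sqrt_pos.2 hpos).ne'
  refine HasDerivAt.congr_deriv (f := smoothHinge ς) h ?_
  rw [hingeSlope]
  field_simp
  ring

lemma hasFDerivAt_margin (b : Fin c → ℝ) (s : Sample c d) (w : Weights c d) (k : Fin c) :
    HasFDerivAt (fun w => margin b w s k)
      ((innerSL ℝ s.1).comp (classWeightCLM k - classWeightCLM s.2)) w := by
  have h : (fun w => margin b w s k) = fun w =>
      (innerSL ℝ s.1).comp (classWeightCLM k - classWeightCLM s.2) w + (1 - b s.2 + b k) := by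
    funext w
    simp only [margin, ContinuousLinearMap.comp_apply, sub_apply,
      classWeightCLM_apply, innerSL_apply_apply, inner_sub_right, real_inner_comm s.1]
    ring
  rw [h]
  exact (ContinuousLinearMap.hasFDerivAt _).add_const _

/-- Each pair k < l contributes to the blocks of both classes; this regroups the contributions by
block. -/
lemma sum_lt_add_swap (F : Fin c → Fin c → ℝ) :
    ∑ k, ∑ l with k < l, (F k l + F l k) = ∑ k, ∑ l with l ≠ k, F k l := by
  simp only [Finset.sum_add_distrib, Finset.sum_filter]
  rw [Finset.sum_comm (f := fun k l => if k < l then F l k else 0), ← Finset.sum_add_distrib]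
  refine Finset.sum_congr rfl fun k _ => ?_
  rw [← Finset.sum_add_distrib]
  refine Finset.sum_congr rfl fun l _ => ?_
  rcases lt_trichotomy k l with h | h | h
  · simp [h, h.ne', h.not_gt]
  · simp [h]
  · simp [h, h.ne, h.not_gt]

lemma inner_weights (g h : Weights c d) :
    inner ℝ g h = ∑ k, inner ℝ (classWeight g k) (classWeight h k) := by
  simp only [PiLp.inner_apply, classWeight]
  rw [Fintype.sum_prod_type]

lemma classWeight_exampleGradient (lam μ ς : ℝ) (b : Fin c → ℝ) (s : Sample c d) (w : Weights c d)
    (k : Fin c) : classWeight (exampleGradient lam μ ς b s w) k = gradBlock lam μ ς b s w k := rfl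

theorem hasGradientAt_exampleObjective (lam μ : ℝ) {ς : ℝ} (hς : 0 < ς) (b : Fin c → ℝ)
    (s : Sample c d) (w : Weights c d) :
    HasGradientAt (exampleObjective lam μ ς b s) (exampleGradient lam μ ς b s w) w := by
  rw [hasGradientAt_iff_hasFDerivAt]
  have h1 : HasFDerivAt (fun w => ∑ k with k ≠ s.2, smoothHinge ς (margin b w s k))
      (∑ k with k ≠ s.2, hingeSlope ς (margin b w s k) •
        ((innerSL ℝ s.1).comp (classWeightCLM k - classWeightCLM s.2))) w :=
    HasFDerivAt.fun_sum fun k _ =>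
      (hasDerivAt_smoothHinge hς _).comp_hasFDerivAt w (hasFDerivAt_margin b s w k)
  have h2 : HasFDerivAt
      (fun w : Weights c d => ∑ k, ∑ l with k < l, ‖classWeight w k - classWeight w l‖ ^ 2)
      (∑ k, ∑ l with k < l, 2 • (innerSL ℝ (classWeight w k - classWeight w l)).comp
        (classWeightCLM k - classWeightCLM l)) w :=
    HasFDerivAt.fun_sum fun k _ => HasFDerivAt.fun_sum fun l _ =>
      ((classWeightCLM k - classWeightCLM l).hasFDerivAt (x := w)).norm_sq
  have h3 : HasFDerivAt (fun w : Weights c d => ‖w‖ ^ 2 + ∑ k, b k ^ 2)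
      (2 • (innerSL ℝ w).comp (ContinuousLinearMap.id ℝ _)) w :=
    ((hasFDerivAt_id w).norm_sq).add_const _
  refine ((h1.add (h2.const_mul lam)).add (h3.const_mul μ)).congr_fderiv ?_
  ext h
  have hsym := sum_lt_add_swap fun k l =>
    inner ℝ (classWeight w k - classWeight w l) (classWeight h k)
  have hsym' : ∑ k, ∑ l with k < l, inner ℝ (classWeight w k - classWeight w l)
      (classWeight h k - classWeight h l)
      = ∑ k, ∑ l with l ≠ k, inner ℝ (classWeight w k - classWeight w l) (classWeight h k) := by
    rw [← hsym]
    refine Finset.sum_congr rfl fun k _ => Finset.sum_congr rfl fun l _ => ?_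
    simp only [inner_sub_left, inner_sub_right]
    ring
  -- Every margin contains the weight of the true class, so its block collects all slopes with a
  -- minus sign.
  have hblock : ∑ k, inner ℝ (if k = s.2
        then -∑ l with l ≠ k, hingeSlope ς (margin b w s l) • s.1
        else hingeSlope ς (margin b w s k) • s.1) (classWeight h k)
      = ∑ k with k ≠ s.2, hingeSlope ς (margin b w s k) *
          (inner ℝ s.1 (classWeight h k) - inner ℝ s.1 (classWeight h s.2)) := by
    rw [← Finset.sum_filter_add_sum_filter_not Finset.univ (fun k => k ≠ s.2)]
    have hy : Finset.univ.filter (fun k => ¬ k ≠ s.2) = {s.2} := by ext; simp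
    simp only [mul_sub]
    rw [hy, Finset.sum_singleton, if_pos rfl, Finset.sum_sub_distrib, sub_eq_add_neg]
    congr 1
    · refine Finset.sum_congr rfl fun k hk => ?_
      rw [if_neg (by simpa using hk), real_inner_smul_left]
    · simp [inner_neg_left, sum_inner, real_inner_smul_left]
  simp only [InnerProductSpace.toDual_apply_apply, inner_weights, classWeight_exampleGradient,
    gradBlock, inner_add_left, Finset.sum_add_distrib, hblock, real_inner_smul_left, sum_inner,
    ← Finset.mul_sum, ← hsym']
  simp [inner_weights, sum_apply, Finset.mul_sum]
  refine congrArg₂ (· + ·) (congrArg₂ (· + ·) rfl ?_) ?_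
  · refine Finset.sum_congr rfl fun k _ => Finset.sum_congr rfl fun l _ => ?_
    simp only [inner_sub_left, inner_sub_right]
    ring
  · refine Finset.sum_congr rfl fun k _ => ?_
    ring

end Gradient

/-- The constants of the privacy accounting. -/
lemma privacy_accounting {K ε Λ σ q : ℝ} {T m : ℕ} (hK : 0 < K) (hε : 0 < ε) (hΛ : 0 < Λ)
    (hεK : ε ≤ K * Λ) (hεT : ε < 1 * q ^ 2 * T) (hq0 : 0 ≤ q)
    (hσ : √(608 * (2 + K)) * (q * √(T * Λ) / ε) ≤ σ) (hm0 : 2 * Λ / ε ≤ m)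
    (hm1 : (m : ℝ) < 2 * Λ / ε + 1) :
    0 < σ ∧ 4 * ((m : ℝ) + 1) * (1 / σ ^ 2) ≤ 1 ∧
      T * (76 * (q ^ 2 * ((m : ℝ) + 1) ^ 2 * (1 / σ ^ 2))) ≤ m * ε / 2 := by
  have hqT : 0 < q ^ 2 * T := by linarith
  have hq : 0 < q := by
    rcases hq0.eq_or_lt with h | h
    · subst h; simp at hqT
    · exact h
  have hT : (0 : ℝ) < T := by
    by_contra! h
    nlinarith [sq_nonneg q]
  have hpos : 0 < √(608 * (2 + K)) * (q * √(T * Λ) / ε) := by positivity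
  have hσ0 : 0 < σ := hpos.trans_le hσ
  have hsq : 608 * (2 + K) * (q ^ 2 * (T * Λ) / ε ^ 2) ≤ σ ^ 2 := by
    have := pow_le_pow_left₀ hpos.le hσ 2
    rwa [mul_pow, div_pow, mul_pow, Real.sq_sqrt (by positivity), Real.sq_sqrt (by positivity)]
      at this
  have hmpos : 0 < (m : ℝ) := lt_of_lt_of_le (by positivity) hm0
  have hm1' : (1 : ℝ) ≤ m := by exact_mod_cast hmpos
  have hmε : m * ε ≤ (2 + K) * Λ := by
    have h1 : (m : ℝ) * ε < (2 * Λ / ε + 1) * ε := by gcongr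
    have h2 : (2 * Λ / ε + 1) * ε = 2 * Λ + ε := by field_simp
    linarith
  -- Both claims come from this bound. The 608 = 76 · 4 · 2 combines (m + 1)² ≤ 4m² with the target
  -- mε/2, and 2 + K comes from mε ≤ 2Λ + ε. Since ε < q²T, it also forces 608 m ≤ σ².
  have hmain : 608 * (q ^ 2 * T) * m ≤ σ ^ 2 * ε := by
    have h1 : 608 * (2 + K) * (q ^ 2 * (T * Λ) / ε ^ 2) * ε
        = 608 * (q ^ 2 * T) * ((2 + K) * Λ) / ε := by
      field_simp
    have h2 := mul_le_mul_of_nonneg_right hsq hε.le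
    rw [h1, div_le_iff₀ hε] at h2
    have h3 := mul_le_mul_of_nonneg_left hmε (by positivity : 0 ≤ 608 * (q ^ 2 * T))
    have h4 : 608 * (q ^ 2 * T) * m * ε ≤ σ ^ 2 * ε * ε := by linarith
    exact le_of_mul_le_mul_right h4 hε
  have hσ2 : 0 < σ ^ 2 := by positivity
  refine ⟨hσ0, ?_, ?_⟩
  · rw [mul_one_div, div_le_one hσ2]
    have h1 : 608 * (q ^ 2 * T) * m ≤ σ ^ 2 * (q ^ 2 * T) := hmain.trans (by gcongr; linarith)
    have h2 : 608 * (m : ℝ) ≤ σ ^ 2 := by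
      refine le_of_mul_le_mul_right ?_ hqT
      linarith
    linarith
  · have h1 : ((m : ℝ) + 1) ^ 2 ≤ 4 * m * m := by nlinarith
    have h2 : (T : ℝ) * (76 * (q ^ 2 * ((m : ℝ) + 1) ^ 2 * (1 / σ ^ 2)))
        = 76 * (q ^ 2 * T) * (m + 1) ^ 2 / σ ^ 2 := by ring
    rw [h2, div_le_iff₀ hσ2]
    have h3 := mul_le_mul_of_nonneg_left h1 (by positivity : 0 ≤ 76 * (q ^ 2 * T))
    have h4 := mul_le_mul_of_nonneg_right hmain hmpos.le
    linarith

/-! ### Choice of the moment order and conclusion. -/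

section Main
variable {n c d T : ℕ}

lemma norm_exampleShift_sq_div_le (lam μ ς : ℝ) (b : Fin c → ℝ) {B R σ : ℝ} (hB : 1 ≤ B)
    (hR : 0 < R) (hσ : 0 < σ) (s : Option (Sample c d)) (w : Weights c d) :
    ‖exampleShift lam μ ς b B R s w‖ ^ 2 / (R * σ) ^ 2 ≤ 1 / σ ^ 2 := by
  have h : ‖exampleShift lam μ ς b B R s w‖ ≤ R := by
    rw [exampleShift, norm_smul, Real.norm_of_nonneg (by positivity)]
    refine (mul_le_of_le_one_left (norm_nonneg _) ?_).trans (norm_clippedGradient_le _ _ _ _ hR _ _)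
    rw [div_le_one (by linarith)]
    exact hB
  rw [div_le_div_iff₀ (by positivity) (by positivity), one_mul, mul_pow]
  gcongr

theorem isDP_iterates {K : ℝ} (hK : 0 < K) (lam μ ς : ℝ) (b : Fin c → ℝ) (w₀ : Weights c d)
    (η : Fin T → ℝ) {B R σ ε δ : ℝ} (q : unitInterval) (hB : 1 ≤ B) (hR : 0 < R) (hε : 0 < ε)
    (hδ0 : 0 < δ) (hδ1 : δ < 1) (hεK : ε ≤ K * Real.log (1 / δ)) (hεT : ε < 1 * (q : ℝ) ^ 2 * T)
    (hσ : √(608 * (2 + K)) * ((q : ℝ) * √(T * Real.log (1 / δ)) / ε) ≤ σ) :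
    IsDP Neighbors (noiseLaw n c d T q R σ) (iterates lam μ ς b B R η w₀) ε δ := by
  set Λ := Real.log (1 / δ) with hΛdef
  have hΛ : 0 < Λ := Real.log_pos (by rw [lt_div_iff₀ hδ0]; linarith)
  -- The moments use at most half of the decay e^(-mε), and mε ≥ 2Λ makes the remaining e^(-mε/2) at
  -- most δ.
  set m := ⌈2 * Λ / ε⌉₊ with hm
  have hm0 : 2 * Λ / ε ≤ m := Nat.le_ceil _
  have hm1 : (m : ℝ) < 2 * Λ / ε + 1 := Nat.ceil_lt_add_one (by positivity)
  obtain ⟨hσ0, h4, hT⟩ := privacy_accounting hK hε hΛ hεK hεT q.2.1 hσ hm0 hm1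
  have hτ : R * σ ≠ 0 := by positivity
  refine isDP_iterates_of_moment lam μ ς b B R σ q hτ η w₀ m (fun s s' w =>
    lintegral_mixRatio_pow_mul_inv_pow_le hτ q.2.1 q.2.2
      (norm_exampleShift_sq_div_le lam μ ς b hB hR hσ0 s w)
      (norm_exampleShift_sq_div_le lam μ ς b hB hR hσ0 s' w) m h4) ?_
  rw [← ENNReal.ofReal_pow (Real.exp_pos _).le, ← ENNReal.ofReal_mul (Real.exp_pos _).le,
    ← Real.exp_nat_mul, ← Real.exp_add]
  refine ENNReal.ofReal_le_ofReal ?_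
  have hlog : Λ = -Real.log δ := by rw [hΛdef, one_div, Real.log_inv]
  rw [← Real.le_log_iff_exp_le hδ0]
  rw [div_le_iff₀ hε] at hm0
  linarith

end Main
end PMSVM
end

theorem mainTheorem3 :
    (∀ (c d : ℕ) (lam μ ς : ℝ) (b : Fin c → ℝ) (s : PMSVM.Sample c d) (w : PMSVM.Weights c d),
      0 < ς →
      HasGradientAt (PMSVM.exampleObjective lam μ ς b s)
        (PMSVM.exampleGradient lam μ ς b s w) w) ∧
    ∀ K : ℝ, 0 < K → ∃ c₁ c₂ : ℝ, 0 < c₁ ∧ 0 < c₂ ∧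
      ∀ (n c d T : ℕ) (lam μ ς : ℝ) (b : Fin c → ℝ) (w₀ : PMSVM.Weights c d) (η : Fin T → ℝ)
        (B R σ ε δ : ℝ) (q : unitInterval),
        0 < ς → 1 ≤ B → 0 < R → 0 < ε → 0 < δ → δ < 1 →
        ε ≤ K * Real.log (1 / δ) →
        ε < c₁ * (q : ℝ) ^ 2 * T →
        c₂ * ((q : ℝ) * √(T * Real.log (1 / δ)) / ε) ≤ σ →
        PMSVM.IsDP PMSVM.Neighbors (PMSVM.noiseLaw n c d T q R σ)
          (PMSVM.iterates lam μ ς b B R η w₀) ε δ ∧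
        PMSVM.IsDP PMSVM.Neighbors (PMSVM.noiseLaw n c d T q R σ)
          (PMSVM.finalWeight lam μ ς b B R η w₀) ε δ := by
  refine ⟨fun c d lam μ ς b s w hς => PMSVM.hasGradientAt_exampleObjective lam μ hς b s w,
    fun K hK => ⟨1, √(608 * (2 + K)), one_pos, by positivity, ?_⟩⟩
  intro n c d T lam μ ς b w₀ η B R σ ε δ q _ hB hR hε hδ0 hδ1 hεK hεT hσ
  have h := PMSVM.isDP_iterates (n := n) hK lam μ ς b w₀ η q hB hR hε hδ0 hδ1 hεK hεT hσ
  exact ⟨h, PMSVM.isDP_finalWeight lam μ ς b B R σ q h⟩
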